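/- **Setting.** Let $G$ be a finite connected multigraph (loops and multiple edges allowed, nonempty vertex set) with oriented edges; the edge $e$ has tail $e^-$, head $e^+$ and length $\ell(e)>0$. Let $\Gamma$ be the tropical curve (metric graph) obtained by gluing the intervals $[0,\ell(e)]$ along their endpoints according to $G$; the image of $[0,\ell(e)]$ is the segment $e$ of $\Gamma$, and the image of $(0,\ell(e))$ is its interior. Let $$\Omega(\Gamma)=\Big\{\omega=\sum_e\omega_e\,de : \sum_{e^+=x}\omega_e=\sum_{e^-=x}\omega_e \text{ for every vertex } x\Big\},\quad \omega_e\in\mathbb R,$$ be the space of harmonic $1$-forms and $\Omega_{\mathbb Z}(\Gamma)$ the subgroup of those with all $\omega_e\in\mathbb Z$. For a $1$-chain $\alpha=\sum_e\alpha_e\,e$ let $\int_\alpha\in\Omega(\Gamma)^*$ be the functional $\omega\mapsto\sum_e\alpha_e\omega_e\ell(e)$. Let $H_1(\Gamma,\mathbb Z)$ be the group of integral $1$-cycles of $G$, identified with its image in $\Omega(\Gamma)^*$ under $\alpha\mapsto\int_\alpha$; let $J(\Gamma)=\Omega(\Gamma)^*/H_1(\Gamma,\mathbb Z)$ with the quotient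 topology, and $$\Omega_{\mathbb Z}(\Gamma)^*=\{\varphi\in\Omega(\Gamma)^* : \varphi(\omega)\in\mathbb Z \text{ for all } \omega\in\Omega_{\mathbb Z}(\Gamma)\}.$$ An element $\lambda$ of this lattice is primitive if it is not of the form $t\lambda'$ with $\lambda'$ in the lattice and an integer $t>1$. A refinement of $G$ is obtained by subdividing its edges at finitely many points, with the induced lengths and orientations; harmonic forms are pushed forward to it by giving each part of $e$ the coefficient $\omega_e$. A subgraph of $\Gamma$ is a union of vertices and closed segments of a refinement of $G$. The Abel–Jacobi map $\Phi_p:\Gamma\to J(\Gamma)$ with base point $p\in\Gamma$ sends $q$ to the class of $\int_{\alpha_P}$, where $P$ is a path from $p$ to $q$ in a refinement having $p$ and $q$ as vertices, and $\alpha_P$ is the $1$-chain counting with sign how often $P$ traverses each edge. A continuous map $f:\Gamma\to J(\Gamma)$ is tropical if (i) it is piecewise affine: on each segment of some refinement it is of the form $t\mapsto [w+tv]$ with $w,v\in\Omega(\Gamma)^*$, where $t$ is arc length; (ii) its differential maps every integral tangent vector (tangent vector of integer length along a segment) of $\Gamma$ into $\Omega_{\mathbb Z}(\Gamma)^*$;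 (iii) at every point $q\in\Gamma$, the images under the differential of the unit tangent vectors at $q$ (one for each direction emanating from $q$) have sum $0$. **Theorem.** Let $p\in\Gamma$. Then $\Phi_p$ is well defined, i.e. $\Phi_p(q)$ does not depend on the choice of the refinement and of the path, and the following hold. 1. $\Phi_p$ is continuous. 2. The restriction of $\Phi_p$ to any simply connected subgraph $\Gamma_1$ containing $p$ has a continuous lift $\widetilde\Phi_p:\Gamma_1\to\Omega(\Gamma)^*$ along the projection $\Omega(\Gamma)^*\to J(\Gamma)$; there is exactly one such lift with $\widetilde\Phi_p(p)=0$. 3. If $e$ is a segment of $\Gamma$ such that the complement in $\Gamma$ of the interior of $e$ is disconnected, then $\Phi_p$ maps $e$ to a point. 4. If $e$ is a segment of $\Gamma$ such that the complement of the interior of $e$ is connected, then for any simply connected subgraph $\Gamma_1$ containing $p$ and $e$ and any continuous lift $\widetilde\Phi_p$ as in (2) (normalized or not), $\widetilde\Phi_p$ maps $e$ affinely in arc length onto a straight segment of $\Omega(\Gamma)^*$ with distinct endpoints. 5. For every segment $e$ of $\Gamma$, $\frac1{\ell(e)}\int_e\in\Omega_{\mathbb Z}(\Gamma)^*$; if $\int_e\neq0$,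 then $\frac1{\ell(e)}\int_e$ is a primitive element of $\Omega_{\mathbb Z}(\Gamma)^*$. 6. $\Phi_p$ is tropical. -/

import Mathlib

open Set Topology

universe u v w

noncomputable section

/-- Paths `x₀, e₁, x₁, …, eₙ, xₙ` in a multigraph with endpoint maps `tail` and `head`; each edge is
traversed either along its orientation (`forward`) or against it (`backward`). -/
inductive EdgePath {V : Type u} {E : Type v} (tail head : E → V) : V → V → Type (max u v)
  | nil (x : V) : EdgePath tail head x x
  | forward {x y z : V} (e : E) (hx : tail e = x) (hy : head e = y)
      (P : EdgePath tail head y z) : EdgePath tail head x z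
  | backward {x y z : V} (e : E) (hx : head e = x) (hy : tail e = y)
      (P : EdgePath tail head y z) : EdgePath tail head x z

namespace EdgePath

variable {V : Type u} {E : Type v} {tail head : E → V}

open scoped Classical in
/-- The integral `1`-chain of a path: an edge `e` gets the number of traversals of `e` along its
orientation minus the number of traversals against it. -/
def chain {x y : V} : EdgePath tail head x y → E → ℤ
  | nil _ => 0
  | forward e _ _ P => Pi.single e 1 + P.chain
  | backward e _ _ P => Pi.single e (-1) + P.chain

def trans {x y z : V} : EdgePath tail head x y → EdgePath tail head y z → EdgePath tail head x z
  | nil _, Q => Q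
  | forward e hx hy P, Q => forward e hx hy (P.trans Q)
  | backward e hx hy P, Q => backward e hx hy (P.trans Q)

def symm {x y : V} : EdgePath tail head x y → EdgePath tail head y x
  | nil x => nil x
  | forward e hx hy P => P.symm.trans (backward e hy hx (nil _))
  | backward e hx hy P => P.symm.trans (forward e hy hx (nil _))

end EdgePath

/-- Connected multigraphs (loops and multiple edges allowed) with oriented edges of positive
length. -/
structure WeightedGraph (V : Type u) (E : Type v) where
  tail : E → V
  head : E → V
  len : E → ℝ
  len_pos : ∀ e, 0 < len e
  nonempty : Nonempty V
  connected : ∀ x y : V, Nonempty (EdgePath tail head x y)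

namespace WeightedGraph

variable {V : Type u} {E : Type v} (G : WeightedGraph V E)

/-! ### Harmonic forms, cycles, and the Jacobian -/

section Jacobian

variable [Fintype E]

open scoped Classical in
/-- The space of harmonic `1`-forms `∑ ωₑ de`, where a `1`-form is identified with its
coefficients. -/
def harmonicForms : Submodule ℝ (E → ℝ) where
  carrier := {ω | ∀ x : V, ∑ e with G.head e = x, ω e = ∑ e with G.tail e = x, ω e}
  zero_mem' := by simp
  add_mem' := by
    intro a b ha hb x
    simp only [Pi.add_apply, Finset.sum_add_distrib]
    rw [ha x, hb x]
  smul_mem' := by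
    intro c a ha x
    simp only [Pi.smul_apply, ← Finset.smul_sum]
    rw [ha x]

open scoped Classical in
/-- The group of integral `1`-cycles `H₁(G, ℤ) = ker d*`. -/
def integralCycles : AddSubgroup (E → ℤ) where
  carrier := {α | ∀ x : V, ∑ e with G.head e = x, α e - ∑ e with G.tail e = x, α e = 0}
  zero_mem' := by simp
  add_mem' := by
    intro a b ha hb x
    have h1 := ha x
    have h2 := hb x
    simp only [Pi.add_apply, Finset.sum_add_distrib]
    linarith
  neg_mem' := by
    intro a ha x
    have h1 := ha x
    simp only [Pi.neg_apply, Finset.sum_neg_distrib]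
    linarith

/-- The integral of the `1`-form `∑ ωₑ de` along the integral `1`-chain `∑ αₑ e`; it is bilinear
and `∫_{e'} de` is `ℓ(e)` if `e = e'` and `0` otherwise. -/
def integral (α : E → ℤ) (ω : E → ℝ) : ℝ := ∑ e, (α e : ℝ) * ω e * G.len e

/-- The dual `Ω*` of the space of harmonic forms. All linear functionals on this
finite-dimensional space are continuous, and the norm topology of `Ω*` is its unique
vector space topology. -/
def HarmonicDual : Type v := StrongDual ℝ G.harmonicForms

namespace HarmonicDual

instance : NormedAddCommGroup G.HarmonicDual :=
  inferInstanceAs (NormedAddCommGroup (StrongDual ℝ G.harmonicForms))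

instance : NormedSpace ℝ G.HarmonicDual :=
  inferInstanceAs (NormedSpace ℝ (StrongDual ℝ G.harmonicForms))

instance : FiniteDimensional ℝ G.HarmonicDual :=
  inferInstanceAs (FiniteDimensional ℝ (StrongDual ℝ G.harmonicForms))

instance : FunLike G.HarmonicDual G.harmonicForms ℝ :=
  inferInstanceAs (FunLike (StrongDual ℝ G.harmonicForms) G.harmonicForms ℝ)

instance : ContinuousLinearMapClass G.HarmonicDual ℝ G.harmonicForms ℝ :=
  inferInstanceAs (ContinuousLinearMapClass (StrongDual ℝ G.harmonicForms) ℝ G.harmonicForms ℝ)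

variable {G}

@[ext] theorem ext {φ ψ : G.HarmonicDual} (h : ∀ ω, φ ω = ψ ω) : φ = ψ := DFunLike.ext _ _ h

@[simp] theorem zero_apply (ω : G.harmonicForms) : (0 : G.HarmonicDual) ω = 0 := rfl

@[simp] theorem add_apply (φ ψ : G.HarmonicDual) (ω : G.harmonicForms) :
    (φ + ψ) ω = φ ω + ψ ω := rfl

@[simp] theorem neg_apply (φ : G.HarmonicDual) (ω : G.harmonicForms) : (-φ) ω = -φ ω := rfl

@[simp] theorem sub_apply (φ ψ : G.HarmonicDual) (ω : G.harmonicForms) :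
    (φ - ψ) ω = φ ω - ψ ω := rfl

@[simp] theorem smul_apply (c : ℝ) (φ : G.HarmonicDual) (ω : G.harmonicForms) :
    (c • φ) ω = c * φ ω := rfl

/-- A linear functional as an element of `Ω*`. -/
def ofLinear (φ : G.harmonicForms →ₗ[ℝ] ℝ) : G.HarmonicDual :=
  (LinearMap.toContinuousLinearMap φ : StrongDual ℝ G.harmonicForms)

@[simp] theorem ofLinear_apply (φ : G.harmonicForms →ₗ[ℝ] ℝ) (ω : G.harmonicForms) :
    ofLinear φ ω = φ ω := rfl

end HarmonicDual

/-- The functional `∫_α` on harmonic forms. -/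
def integralFunctional (α : E → ℤ) : G.HarmonicDual :=
  HarmonicDual.ofLinear
    { toFun := fun ω => G.integral α ω
      map_add' := by
        intro a b
        simp [integral, mul_add, add_mul, Finset.sum_add_distrib]
      map_smul' := by
        intro c a
        simp only [integral, Finset.mul_sum, RingHom.id_apply, smul_eq_mul, Submodule.coe_smul,
          Pi.smul_apply]
        exact Finset.sum_congr rfl fun e _ => by ring }

open scoped Classical in
/-- The functional `∫_e` for an edge `e`. -/
def edgeFunctional (e : E) : G.HarmonicDual := G.integralFunctional (Pi.single e 1)

/-- The image of `H₁(G, ℤ)` in `Ω*`. -/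
def periods : AddSubgroup G.HarmonicDual where
  carrier := {φ | ∃ α ∈ G.integralCycles, G.integralFunctional α = φ}
  zero_mem' := ⟨0, zero_mem _, by ext ω; simp [integralFunctional, integral]⟩
  add_mem' := by
    rintro _ _ ⟨a, ha, rfl⟩ ⟨b, hb, rfl⟩
    refine ⟨a + b, add_mem ha hb, ?_⟩
    ext ω
    simp [integralFunctional, integral, add_mul, Finset.sum_add_distrib]
  neg_mem' := by
    rintro _ ⟨a, ha, rfl⟩
    refine ⟨-a, neg_mem ha, ?_⟩
    ext ω
    simp [integralFunctional, integral]

/-- The Jacobian `Ω* / H₁(G, ℤ)` of the tropical curve realizing `G`, with the quotient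
topology. -/
abbrev Jacobian : Type v := G.HarmonicDual ⧸ G.periods

/-- The lattice in `Ω*` dual to the lattice of harmonic `1`-forms with integer coefficients. -/
def integralDual : AddSubgroup G.HarmonicDual where
  carrier := {φ | ∀ ω : G.harmonicForms,
    (∀ e, ∃ n : ℤ, (ω : E → ℝ) e = n) → ∃ m : ℤ, φ ω = m}
  zero_mem' := fun _ _ => ⟨0, by simp⟩
  add_mem' := by
    intro a b ha hb ω hω
    obtain ⟨m, hm⟩ := ha ω hω
    obtain ⟨n, hn⟩ := hb ω hω
    exact ⟨m + n, by simp [hm, hn]⟩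
  neg_mem' := by
    intro a ha ω hω
    obtain ⟨m, hm⟩ := ha ω hω
    exact ⟨-m, by simp [hm]⟩

end Jacobian

/-! ### The geometric realization -/

/-- The gluing relation on the disjoint union of the vertex set and the intervals `[0, ℓ(e)]`: the
left endpoint is glued to the tail and the right endpoint to the head of `e`. -/
inductive Glue : V ⊕ (Σ e : E, Icc (0 : ℝ) (G.len e)) → V ⊕ (Σ e : E, Icc (0 : ℝ) (G.len e)) → Prop
  | tail (e : E) : Glue (Sum.inr ⟨e, 0, le_rfl, (G.len_pos e).le⟩) (Sum.inl (G.tail e))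
  | head (e : E) : Glue (Sum.inr ⟨e, G.len e, (G.len_pos e).le, le_rfl⟩) (Sum.inl (G.head e))

/-- The tropical curve realizing `G`: the intervals `[0, ℓ(e)]` glued along their endpoints. -/
def Curve : Type (max u v) := Quot G.Glue

/-- The quotient topology, the vertex set being discrete. -/
instance : TopologicalSpace G.Curve :=
  letI : TopologicalSpace V := ⊥
  inferInstanceAs (TopologicalSpace (Quot G.Glue))

/-- The point of the curve given by a vertex. -/
def vertexPoint (x : V) : G.Curve := Quot.mk _ (Sum.inl x)

/-- The unit-speed parametrization of the segment `e` by `[0, ℓ(e)]` (constant outside this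
interval). -/
def point (e : E) (t : ℝ) : G.Curve :=
  Quot.mk _ (Sum.inr ⟨e, projIcc 0 (G.len e) (G.len_pos e).le t⟩)

/-- The (closed) segment of the curve given by an edge. -/
def segment (e : E) : Set G.Curve := G.point e '' Icc 0 (G.len e)

/-- The interior of the segment given by an edge: the open edge, without its endpoints. -/
def openSegment (e : E) : Set G.Curve := G.point e '' Ioo 0 (G.len e)

open scoped Classical in
/-- The disjoint form of a point: a vertex, or an edge with a position in its interior. -/
def normalForm : G.Curve → V ⊕ (E × ℝ) :=
  Quot.lift
    (fun a => match a with
      | Sum.inl x => Sum.inl x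
      | Sum.inr ⟨e, t⟩ =>
        if (t : ℝ) = 0 then Sum.inl (G.tail e)
        else if (t : ℝ) = G.len e then Sum.inl (G.head e) else Sum.inr (e, (t : ℝ)))
    (by
      intro a b h
      cases h with
      | tail e => simp
      | head e => simp [(G.len_pos e).ne'])

open scoped Classical in
theorem normalForm_point (e : E) {t : ℝ} (ht : t ∈ Icc 0 (G.len e)) :
    G.normalForm (G.point e t) =
      if t = 0 then Sum.inl (G.tail e)
      else if t = G.len e then Sum.inl (G.head e) else Sum.inr (e, t) := by
  unfold point normalForm
  rw [projIcc_of_mem (G.len_pos e).le ht]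

/-! ### Refinements -/

/-- A length-preserving subdivision of the edges of `G`: finitely many new vertices in the interior
of each segment. -/
structure Subdivision where
  pts : E → Finset ℝ
  pts_mem : ∀ e, ∀ t ∈ pts e, t ∈ Ioo 0 (G.len e)

namespace Subdivision

variable {G} (S : G.Subdivision)

/-- The vertices of the refined graph: the old vertices and the subdivision points. -/
abbrev Vert (S : G.Subdivision) : Type (max u v) := V ⊕ (Σ e : E, {t : ℝ // t ∈ S.pts e})

/-- The edges of the refined graph. The edge `⟨e, s⟩` is the part of `e` from `s` to the next
subdivision point (or to the end of `e`); here `s` is `0` or a subdivision point. -/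
abbrev Edge (S : G.Subdivision) : Type v := Σ e : E, {s : ℝ // s ∈ insert 0 (S.pts e)}

theorem lt_len {e : E} {s : ℝ} (hs : s ∈ insert 0 (S.pts e)) : s < G.len e := by
  rcases Finset.mem_insert.1 hs with rfl | h
  · exact G.len_pos e
  · exact (S.pts_mem e s h).2

theorem nonempty_later (a : S.Edge) :
    ((insert (G.len a.1) (S.pts a.1)).filter (fun t => (a.2 : ℝ) < t)).Nonempty :=
  ⟨G.len a.1, Finset.mem_filter.2 ⟨Finset.mem_insert_self _ _, S.lt_len a.2.2⟩⟩

/-- The right endpoint of an edge of the refined graph. -/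
def next (a : S.Edge) : ℝ :=
  ((insert (G.len a.1) (S.pts a.1)).filter (fun t => (a.2 : ℝ) < t)).min' (S.nonempty_later a)

theorem lt_next (a : S.Edge) : (a.2 : ℝ) < S.next a :=
  (Finset.mem_filter.1 (Finset.min'_mem _ (S.nonempty_later a))).2

/-- The vertex of the refined graph at position `t` on `e`, for `t` equal to `0`, to `ℓ(e)`, or to a
subdivision point. -/
def vertexAt (e : E) (t : ℝ) : S.Vert :=
  if h : t ∈ S.pts e then Sum.inr ⟨e, t, h⟩
  else if t = 0 then Sum.inl (G.tail e) else Sum.inl (G.head e)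

theorem vertexAt_zero (e : E) : S.vertexAt e 0 = Sum.inl (G.tail e) := by
  have h : (0 : ℝ) ∉ S.pts e := fun h => lt_irrefl _ (S.pts_mem e 0 h).1
  simp [vertexAt, h]

theorem vertexAt_len (e : E) : S.vertexAt e (G.len e) = Sum.inl (G.head e) := by
  have h : G.len e ∉ S.pts e := fun h => lt_irrefl _ (S.pts_mem e _ h).2
  simp [vertexAt, h, (G.len_pos e).ne']

theorem vertexAt_of_mem {e : E} {t : ℝ} (h : t ∈ S.pts e) :
    S.vertexAt e t = Sum.inr ⟨e, t, h⟩ := by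
  simp [vertexAt, h]

def edgeTail (a : S.Edge) : S.Vert := S.vertexAt a.1 a.2

def edgeHead (a : S.Edge) : S.Vert := S.vertexAt a.1 (S.next a)

theorem exists_pred (e : E) {t : ℝ} (ht : t ∈ insert (G.len e) (S.pts e)) :
    ∃ a : S.Edge, a.1 = e ∧ S.next a = t ∧ (a.2 : ℝ) < t ∧ S.edgeHead a = S.vertexAt e t := by
  have ht0 : 0 < t := by
    rcases Finset.mem_insert.1 ht with rfl | h
    · exact G.len_pos e
    · exact (S.pts_mem e t h).1
  have hne : ((insert 0 (S.pts e)).filter (fun s => s < t)).Nonempty :=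
    ⟨0, Finset.mem_filter.2 ⟨Finset.mem_insert_self _ _, ht0⟩⟩
  have hm := Finset.mem_filter.1 (Finset.max'_mem _ hne)
  set s := ((insert 0 (S.pts e)).filter (fun s => s < t)).max' hne with hs
  have hnext : S.next ⟨e, s, hm.1⟩ = t := by
    apply le_antisymm
    · exact Finset.min'_le _ _ (Finset.mem_filter.2 ⟨ht, hm.2⟩)
    · by_contra hlt
      rw [not_le] at hlt
      have h1 := Finset.mem_filter.1 (Finset.min'_mem _ (S.nonempty_later ⟨e, s, hm.1⟩))
      have h2 : S.next ⟨e, s, hm.1⟩ ∈ S.pts e := by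
        rcases Finset.mem_insert.1 h1.1 with h | h
        · exfalso
          have h3 : t ≤ G.len e := by
            rcases Finset.mem_insert.1 ht with h' | h'
            · exact h'.le
            · exact (S.pts_mem e t h').2.le
          have h4 : S.next ⟨e, s, hm.1⟩ = G.len e := h
          linarith
        · exact h
      have h5 : S.next ⟨e, s, hm.1⟩ ≤ s :=
        Finset.le_max' _ _ (Finset.mem_filter.2 ⟨Finset.mem_insert_of_mem h2, hlt⟩)
      exact absurd (S.lt_next ⟨e, s, hm.1⟩) (not_lt.2 h5)
  exact ⟨⟨e, s, hm.1⟩, rfl, hnext, hm.2, by rw [edgeHead, hnext]⟩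

theorem path_to (e : E) :
    ∀ (n : ℕ) (t : ℝ), t ∈ insert (G.len e) (S.pts e) → ((S.pts e).filter (· < t)).card = n →
      Nonempty (EdgePath S.edgeTail S.edgeHead (Sum.inl (G.tail e)) (S.vertexAt e t)) := by
  intro n
  induction n using Nat.strong_induction_on with
  | _ n ih =>
    intro t ht hn
    obtain ⟨⟨e', s, hs⟩, rfl, -, hlt, hh⟩ := S.exists_pred e ht
    have key : Nonempty (EdgePath S.edgeTail S.edgeHead (Sum.inl (G.tail e'))
        (S.vertexAt e' s)) := by
      rcases Finset.mem_insert.1 hs with h | h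
      · rw [h, S.vertexAt_zero]
        exact ⟨EdgePath.nil _⟩
      · refine ih _ ?_ s (Finset.mem_insert_of_mem h) rfl
        rw [← hn]
        apply Finset.card_lt_card
        refine ⟨fun x hx => ?_, fun hsub => ?_⟩
        · rw [Finset.mem_filter] at hx ⊢
          exact ⟨hx.1, hx.2.trans hlt⟩
        · exact lt_irrefl _ (Finset.mem_filter.1 (hsub (Finset.mem_filter.2 ⟨h, hlt⟩))).2
    obtain ⟨P⟩ := key
    exact ⟨P.trans (EdgePath.forward ⟨e', s, hs⟩ rfl hh (EdgePath.nil _))⟩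

theorem path_of_path {x y : V} (P : EdgePath G.tail G.head x y) :
    Nonempty (EdgePath S.edgeTail S.edgeHead (Sum.inl x) (Sum.inl y)) := by
  induction P with
  | nil x => exact ⟨EdgePath.nil _⟩
  | forward e hx hy P ih =>
    obtain ⟨Q⟩ := ih
    obtain ⟨R⟩ := S.path_to e _ _ (Finset.mem_insert_self _ _) rfl
    rw [S.vertexAt_len, hx, hy] at R
    exact ⟨R.trans Q⟩
  | backward e hx hy P ih =>
    obtain ⟨Q⟩ := ih
    obtain ⟨R⟩ := S.path_to e _ _ (Finset.mem_insert_self _ _) rfl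
    rw [S.vertexAt_len, hx, hy] at R
    exact ⟨R.symm.trans Q⟩

theorem exists_path_old (x : S.Vert) :
    ∃ y : V, Nonempty (EdgePath S.edgeTail S.edgeHead x (Sum.inl y)) := by
  rcases x with x | ⟨e, t, ht⟩
  · exact ⟨x, ⟨EdgePath.nil _⟩⟩
  · obtain ⟨P⟩ := S.path_to e _ t (Finset.mem_insert_of_mem ht) rfl
    rw [S.vertexAt_of_mem ht] at P
    exact ⟨G.tail e, ⟨P.symm⟩⟩

/-- The refinement of `G` given by a subdivision, with the induced lengths and orientations. -/
def graph : WeightedGraph S.Vert S.Edge where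
  tail := S.edgeTail
  head := S.edgeHead
  len a := S.next a - a.2
  len_pos a := sub_pos.2 (S.lt_next a)
  nonempty := G.nonempty.map Sum.inl
  connected := by
    intro x y
    obtain ⟨x', ⟨P⟩⟩ := S.exists_path_old x
    obtain ⟨y', ⟨Q⟩⟩ := S.exists_path_old y
    obtain ⟨R⟩ := G.connected x' y'
    obtain ⟨R'⟩ := S.path_of_path R
    exact ⟨P.trans (R'.trans Q.symm)⟩

/-- The point of the curve given by a vertex of the refinement. -/
def place : S.Vert → G.Curve
  | Sum.inl x => G.vertexPoint x
  | Sum.inr ⟨e, t⟩ => G.point e t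

/-- The segment of the curve given by an edge of the refinement. -/
def subsegment (a : S.Edge) : Set G.Curve := G.point a.1 '' Icc (a.2 : ℝ) (S.next a)

/-- The push-forward of `1`-forms: `de` goes to the sum of the `de'` over the edges `e'` into which
`e` is subdivided. -/
def pushForm (ω : E → ℝ) : S.Edge → ℝ := fun a => ω a.1

end Subdivision

/-! ### The Abel-Jacobi map -/

/-- A path from `p` to `q` in some refinement of `G` that contains `p` and `q` as vertices. -/
structure Connection (p q : G.Curve) where
  sub : G.Subdivision
  start : sub.Vert
  finish : sub.Vert
  place_start : sub.place start = p
  place_finish : sub.place finish = q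
  path : EdgePath sub.graph.tail sub.graph.head start finish

theorem exists_rep (p : G.Curve) :
    (∃ x, p = G.vertexPoint x) ∨ ∃ e, ∃ t ∈ Ioo 0 (G.len e), p = G.point e t := by
  induction p using Quot.ind with
  | _ a =>
    rcases a with x | ⟨e, t, h0, h1⟩
    · exact Or.inl ⟨x, rfl⟩
    · rcases h0.eq_or_lt with h | h
      · subst h
        exact Or.inl ⟨G.tail e, Quot.sound (Glue.tail e)⟩
      · rcases h1.eq_or_lt with h' | h'
        · subst h'
          exact Or.inl ⟨G.head e, Quot.sound (Glue.head e)⟩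
        · refine Or.inr ⟨e, t, ⟨h, h'⟩, ?_⟩
          rw [point, projIcc_of_mem (G.len_pos e).le ⟨h0, h1⟩]

open scoped Classical in
theorem exists_subdivision (p q : G.Curve) :
    ∃ S : G.Subdivision, (∃ x, S.place x = p) ∧ ∃ y, S.place y = q := by
  have one : ∀ p : G.Curve, ∃ A : E → Finset ℝ, (∀ e, ∀ t ∈ A e, t ∈ Ioo 0 (G.len e)) ∧
      ∀ S : G.Subdivision, (∀ e, A e ⊆ S.pts e) → ∃ x, S.place x = p := by
    intro p
    rcases G.exists_rep p with ⟨x, rfl⟩ | ⟨e, t, ht, rfl⟩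
    · exact ⟨fun _ => ∅, by simp, fun S _ => ⟨Sum.inl x, rfl⟩⟩
    · refine ⟨fun e' => if e' = e then {t} else ∅, ?_, fun S hS => ?_⟩
      · intro e' t' h'
        by_cases h : e' = e
        · subst h
          simp only [if_true, Finset.mem_singleton] at h'
          exact h' ▸ ht
        · simp [h] at h'
      · exact ⟨Sum.inr ⟨e, t, hS e (by simp)⟩, rfl⟩
  obtain ⟨A, hA, hA'⟩ := one p
  obtain ⟨B, hB, hB'⟩ := one q
  refine ⟨⟨fun e => A e ∪ B e, fun e t ht => ?_⟩, ?_, ?_⟩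
  · rcases Finset.mem_union.1 ht with h | h
    exacts [hA e t h, hB e t h]
  · exact hA' _ fun e => Finset.subset_union_left
  · exact hB' _ fun e => Finset.subset_union_right

theorem nonempty_connection (p q : G.Curve) : Nonempty (G.Connection p q) := by
  obtain ⟨S, ⟨x, hx⟩, ⟨y, hy⟩⟩ := G.exists_subdivision p q
  obtain ⟨P⟩ := S.graph.connected x y
  exact ⟨⟨S, x, y, hx, hy, P⟩⟩

section AbelJacobi

variable [Fintype E]

/-- The functional `∫_{α_P}` of a path `P` in a refinement, regarded as a functional on the harmonic
forms of `G` through the push-forward of forms. -/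
def Connection.functional {G : WeightedGraph V E} {p q : G.Curve} (c : G.Connection p q) :
    G.HarmonicDual :=
  HarmonicDual.ofLinear
    { toFun := fun ω => c.sub.graph.integral c.path.chain (c.sub.pushForm ω)
      map_add' := by
        intro a b
        simp [integral, Subdivision.pushForm, mul_add, add_mul, Finset.sum_add_distrib]
      map_smul' := by
        intro r a
        simp only [integral, Subdivision.pushForm, Finset.mul_sum, RingHom.id_apply, smul_eq_mul,
          Submodule.coe_smul, Pi.smul_apply]
        exact Finset.sum_congr rfl fun e _ => by ring }

/-- The Abel-Jacobi map with base point `p`: `q` goes to the class of `∫_{α_P}`, where `P` is a path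
from `p` to `q` in some refinement with vertices `p` and `q`. -/
def abelJacobi (p q : G.Curve) : G.Jacobian :=
  QuotientAddGroup.mk (G.nonempty_connection p q).some.functional

/-- `F` is a continuous lift to `Ω*` of the restriction of the Abel-Jacobi map to `X`. -/
def IsLift (p : G.Curve) (X : Set G.Curve) (F : X → G.HarmonicDual) : Prop :=
  Continuous F ∧ ∀ x : X, (QuotientAddGroup.mk (F x) : G.Jacobian) = G.abelJacobi p x

end AbelJacobi

/-- Metric subgraphs of the curve: unions of vertices and (closed) segments of some refinement. -/
def IsSubgraph (X : Set G.Curve) : Prop :=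
  ∃ (S : G.Subdivision) (A : Set S.Vert) (B : Set S.Edge),
    X = S.place '' A ∪ ⋃ a ∈ B, S.subsegment a

/-! ### Tropical maps -/

/-- Unit tangent vectors (primitive integral tangent vectors): a point of a segment together with
one of the directions of this segment that do not point out of it. A vertex has one unit tangent
vector for each emanating segment (two for each loop), any other point has two. -/
@[ext] structure UnitTangent where
  edge : E
  pos : ℝ
  pos_mem : pos ∈ Icc 0 (G.len edge)
  forward : Bool
  forward_lt : forward = true → pos < G.len edge
  backward_lt : forward = false → 0 < pos

namespace UnitTangent

variable {G}

/-- The point reached after time `r` when starting in the direction of a unit tangent vector with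
unit speed, as long as this does not leave the segment. -/
def flow (d : G.UnitTangent) (r : ℝ) : G.Curve :=
  G.point d.edge (if d.forward then d.pos + r else d.pos - r)

/-- The point of the curve at which a unit tangent vector is based. -/
def base (d : G.UnitTangent) : G.Curve := G.point d.edge d.pos

instance [Finite E] (q : G.Curve) : Finite {d : G.UnitTangent // d.base = q} := by
  classical
  apply Finite.of_injective
    (fun d : {d : G.UnitTangent // d.base = q} => (d.1.edge, d.1.forward))
  rintro ⟨⟨e, t, ht, b, h1, h2⟩, hd⟩ ⟨⟨e', t', ht', b', h1', h2'⟩, hd'⟩ h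
  obtain ⟨rfl, rfl⟩ : e = e' ∧ b = b' := by simpa using h
  have key : G.normalForm (G.point e t) = G.normalForm (G.point e t') :=
    congrArg G.normalForm (hd.trans hd'.symm)
  rw [G.normalForm_point e ht, G.normalForm_point e ht'] at key
  have : t = t' := by
    cases b
    · have a1 := h2 rfl
      have a2 := h2' rfl
      rw [if_neg a1.ne', if_neg a2.ne'] at key
      split_ifs at key <;> simp_all
    · have a1 := h1 rfl
      have a2 := h1' rfl
      rw [if_neg a1.ne, if_neg a2.ne] at key
      split_ifs at key <;> simp_all
  subst this
  rfl

end UnitTangent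

section Tropical

variable {W : Type w} [NormedAddCommGroup W] [NormedSpace ℝ W]

/-- `f` is affine on each segment of some refinement. -/
def IsPiecewiseAffine (Λ : AddSubgroup W) (f : G.Curve → W ⧸ Λ) : Prop :=
  ∃ S : G.Subdivision, ∀ a : S.Edge, ∃ w v : W, ∀ t ∈ Icc (a.2 : ℝ) (S.next a),
    f (G.point a.1 t) = QuotientAddGroup.mk (w + t • v)

/-- The differential of `f` sends the unit tangent vector `d` to `v`: along a short piece of curve in
the direction of `d` the map `f` has a continuous lift to `W` with one-sided derivative `v`. -/
def HasDifferential (Λ : AddSubgroup W) (f : G.Curve → W ⧸ Λ) (d : G.UnitTangent) (v : W) : Prop :=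
  ∃ ε > (0 : ℝ), ∃ g : ℝ → W, ContinuousOn g (Ico 0 ε) ∧
    (∀ r ∈ Ico 0 ε, QuotientAddGroup.mk (g r) = f (d.flow r)) ∧
    HasDerivWithinAt g v (Ici 0) 0

/-- Tropical maps to the torus `W / Λ` with the tropical structure `Λ'`. The integral tangent vectors
are the integer multiples of the unit ones, so it suffices to map the latter to `Λ'`. The sum in the
balancing condition is over the finite set of unit tangent vectors at `q`. -/
def IsTropical (Λ Λ' : AddSubgroup W) (f : G.Curve → W ⧸ Λ) : Prop :=
  Continuous f ∧ G.IsPiecewiseAffine Λ f ∧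
    ∃ D : G.UnitTangent → W, (∀ d, G.HasDifferential Λ f d (D d)) ∧ (∀ d, D d ∈ Λ') ∧
      ∀ q : G.Curve, ∑ᶠ d : {d : G.UnitTangent // d.base = q}, D d.1 = 0

end Tropical

end WeightedGraph

/-- Primitive elements of a lattice: those that are not `t • μ` with `μ` in the lattice and an
integer `t > 1`. -/
def IsPrimitiveIn {W : Type w} [AddCommGroup W] (Λ : AddSubgroup W) (l : W) : Prop :=
  l ∈ Λ ∧ ∀ μ ∈ Λ, ∀ t : ℤ, 1 < t → l ≠ t • μ

end

/-! The functional $\int_e/\ell(e)$ (`direction`) is just the coefficient map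
$\omega\mapsto\omega_e$. Together these functionals form a tautological $\Omega^*$-valued $1$-form
on $\Gamma$, and its periods over integral cycles are exactly the lattice that is divided out in the
Jacobian. It therefore has a primitive with values in $J(\Gamma)$, the `potential` $u$, which is
affine on each edge $e$ with velocity `direction e`. Integrating along a path in any refinement
telescopes to $u(q)-u(p)$ (`mk_functional`), so $\Phi_p=u-u(p)$. Well-definedness and continuity
follow, and on an edge everything is governed by `direction e` (`exists_abelJacobi_point`).

The direction of $e$ vanishes exactly when $e$ is a bridge. Without a detour around $e$, summation
by parts against the indicator function of one side forces $\omega_e=0$ (`edgeFunctional_eq_zero`).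
With a detour, there is an integral cycle with coefficient $1$ at $e$; regarded as a harmonic form,
it shows both that the direction is nonzero and that it is primitive. The combinatorial detour is
matched with connectedness of the complement of the open edge by `hasDetour_of_isConnected` and
`HasDetour.isConnected`.

Lifts exist because the periods are discrete (`le_norm_of_mem_periods`), so that $\Omega^*\to
J(\Gamma)$ is a covering, and because subgraphs are locally path connected. Over an edge, a lift
differs from an affine map by a continuous function into a discrete group, hence by a constant.
Finally, the balancing condition at a vertex, evaluated at $\omega$, is the harmonicity of $\omega$
there. -/

namespace WeightedGraph

variable {V : Type u} {E : Type v} (G : WeightedGraph V E)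

/-! ### Maps out of the realization -/

section Realization

theorem point_zero (e : E) : G.point e 0 = G.vertexPoint (G.tail e) := by
  rw [point, projIcc_of_mem (G.len_pos e).le ⟨le_rfl, (G.len_pos e).le⟩]
  exact Quot.sound (Glue.tail e)

theorem point_len (e : E) : G.point e (G.len e) = G.vertexPoint (G.head e) := by
  rw [point, projIcc_of_mem (G.len_pos e).le ⟨(G.len_pos e).le, le_rfl⟩]
  exact Quot.sound (Glue.head e)

theorem continuous_point (e : E) : Continuous (G.point e) := by
  let _ : TopologicalSpace V := ⊥
  have h : Continuous (Quot.mk G.Glue) := continuous_quot_mk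
  exact h.comp (continuous_inr.comp (continuous_sigmaMk.comp continuous_projIcc))

/-- The map out of the realization given by a map on the vertices and compatible maps on the
segments. -/
def curveLift {Y : Type*} (f : V → Y) (g : E → ℝ → Y) (h0 : ∀ e, g e 0 = f (G.tail e))
    (h1 : ∀ e, g e (G.len e) = f (G.head e)) : G.Curve → Y :=
  Quot.lift (Sum.elim f fun a => g a.1 a.2) (by
    intro a b h
    cases h with
    | tail e => exact h0 e
    | head e => exact h1 e)

section CurveLift

variable {Y : Type*} {f : V → Y} {g : E → ℝ → Y} (h0 : ∀ e, g e 0 = f (G.tail e))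
  (h1 : ∀ e, g e (G.len e) = f (G.head e))

theorem curveLift_point (e : E) {t : ℝ} (ht : t ∈ Icc 0 (G.len e)) :
    G.curveLift f g h0 h1 (G.point e t) = g e t := by
  rw [point, projIcc_of_mem (G.len_pos e).le ht]
  rfl

theorem continuous_curveLift [TopologicalSpace Y] (hg : ∀ e, Continuous (g e)) :
    Continuous (G.curveLift f g h0 h1) := by
  let _ : TopologicalSpace V := ⊥
  have : DiscreteTopology V := ⟨rfl⟩
  refine continuous_quot_lift (r := G.Glue) _ (continuous_of_discreteTopology.sumElim ?_)
  exact continuous_sigma fun e => (hg e).comp continuous_subtype_val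

end CurveLift

end Realization

/-! ### Chains and their boundaries -/

section Chains

variable [Fintype E]

open scoped Classical in
/-- The boundary of an integral `1`-chain. -/
noncomputable def boundary : (E → ℤ) →+ (V → ℤ) where
  toFun α x := ∑ e with G.head e = x, α e - ∑ e with G.tail e = x, α e
  map_zero' := by ext x; simp
  map_add' α β := by
    ext x
    simp only [Pi.add_apply, Finset.sum_add_distrib]
    ring

theorem mem_integralCycles_iff {α : E → ℤ} : α ∈ G.integralCycles ↔ G.boundary α = 0 :=
  funext_iff.symm

open scoped Classical in
theorem boundary_single (e : E) (n : ℤ) :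
    G.boundary (Pi.single e n) = Pi.single (G.head e) n - Pi.single (G.tail e) n := by
  ext x
  simp [boundary, Finset.sum_filter, Pi.single_apply, eq_comm, ← ite_and]
  congr 1 <;> rw [Finset.sum_eq_single e] <;> simp +contextual [eq_comm]

open scoped Classical in
theorem boundary_chain {x y : V} (P : EdgePath G.tail G.head x y) :
    G.boundary P.chain = Pi.single y 1 - Pi.single x 1 := by
  induction P with
  | nil x => simp [EdgePath.chain]
  | forward e hx hy P ih =>
    subst hx hy
    simp [EdgePath.chain, ih, boundary_single]
  | backward e hx hy P ih =>
    subst hx hy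
    simp [EdgePath.chain, ih, boundary_single, Pi.single_neg]

/-- An integral cycle as a harmonic form. -/
def cycleForm (α : E → ℤ) (hα : α ∈ G.integralCycles) : G.harmonicForms :=
  ⟨fun e => α e, fun x => by
    have h := hα x
    rw [sub_eq_zero] at h
    simpa using congrArg (Int.cast : ℤ → ℝ) h⟩

@[simp] theorem cycleForm_apply (α : E → ℤ) (hα : α ∈ G.integralCycles) (e : E) :
    (G.cycleForm α hα : E → ℝ) e = α e := rfl

end Chains

/-! ### Functionals -/

section Functionals

variable [Fintype E]

/-- Evaluation at a harmonic form as an additive map. -/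
def HarmonicDual.eval {G : WeightedGraph V E} (ω : G.harmonicForms) : G.HarmonicDual →+ ℝ where
  toFun φ := φ ω
  map_zero' := rfl
  map_add' _ _ := rfl

@[simp] theorem HarmonicDual.sum_apply {G : WeightedGraph V E} {ι : Type*} (s : Finset ι)
    (φ : ι → G.HarmonicDual) (ω : G.harmonicForms) : (∑ i ∈ s, φ i) ω = ∑ i ∈ s, φ i ω :=
  map_sum (HarmonicDual.eval ω) φ s

theorem integralFunctional_apply (α : E → ℤ) (ω : G.harmonicForms) :
    G.integralFunctional α ω = ∑ e, (α e : ℝ) * (ω : E → ℝ) e * G.len e := rfl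

theorem integralFunctional_add (α β : E → ℤ) :
    G.integralFunctional (α + β) = G.integralFunctional α + G.integralFunctional β := by
  ext ω
  simp [integralFunctional_apply, add_mul, Finset.sum_add_distrib]

theorem integralFunctional_neg (α : E → ℤ) :
    G.integralFunctional (-α) = -G.integralFunctional α := by
  ext ω
  simp [integralFunctional_apply]

/-- The functional `∫_e / ℓ(e)`. -/
noncomputable def direction (e : E) : G.HarmonicDual := (1 / G.len e) • G.edgeFunctional e

theorem edgeFunctional_apply (e : E) (ω : G.harmonicForms) :
    G.edgeFunctional e ω = (ω : E → ℝ) e * G.len e := by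
  classical
  rw [edgeFunctional, integralFunctional_apply, Finset.sum_eq_single e] <;>
    simp +contextual

@[simp] theorem direction_apply (e : E) (ω : G.harmonicForms) :
    G.direction e ω = (ω : E → ℝ) e := by
  rw [direction, HarmonicDual.smul_apply, edgeFunctional_apply]
  field_simp [(G.len_pos e).ne']

theorem len_smul_direction (e : E) : G.len e • G.direction e = G.edgeFunctional e := by
  ext ω
  rw [HarmonicDual.smul_apply, direction_apply, edgeFunctional_apply, mul_comm]

theorem direction_mem_integralDual (e : E) : G.direction e ∈ G.integralDual := by
  intro ω hω
  rw [direction_apply]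
  exact hω e

/-- The functional of a chain in a refinement. -/
noncomputable def Subdivision.chainFunctional {G : WeightedGraph V E} (S : G.Subdivision) :
    (S.Edge → ℤ) →+ G.HarmonicDual where
  toFun α := ∑ a, ((α a : ℝ) * (S.next a - a.2)) • G.direction a.1
  map_zero' := by simp
  map_add' α β := by simp [add_mul, add_smul, Finset.sum_add_distrib]

theorem Subdivision.chainFunctional_single {G : WeightedGraph V E} (S : G.Subdivision)
    {_ : DecidableEq S.Edge} (a : S.Edge) (n : ℤ) :
    S.chainFunctional (Pi.single a n) = ((n : ℝ) * (S.next a - a.2)) • G.direction a.1 := by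
  change ∑ b, _ = _
  rw [Finset.sum_eq_single a] <;> simp +contextual

/-- A pushed-forward form has the same coefficient on all parts of an edge of `G`, so each part
contributes its own length times the direction of that edge. -/
theorem Connection.functional_eq {G : WeightedGraph V E} {p q : G.Curve}
    (c : G.Connection p q) : c.functional = c.sub.chainFunctional c.path.chain := by
  ext ω
  change ∑ a, _ = (∑ a, _ : G.HarmonicDual) ω
  simp only [HarmonicDual.sum_apply, HarmonicDual.smul_apply, direction_apply]
  refine Finset.sum_congr rfl fun a _ => ?_
  simp only [Subdivision.pushForm, Subdivision.graph]
  ring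

/-! ### The potential -/

/-- A chain with boundary `x - x₀` for a fixed vertex `x₀`. -/
noncomputable def vertexChain (x : V) : E → ℤ :=
  (G.connected G.nonempty.some x).some.chain

/-- The value at a vertex of a multivalued primitive of the tautological `Ω*`-valued form. -/
noncomputable def vertexValue (x : V) : G.HarmonicDual := G.integralFunctional (G.vertexChain x)

/-- Following the chosen path to the tail, then `e`, then the chosen path to the head backwards
gives a closed chain. This is what makes `potential` compatible with the gluing at the head of `e`.
-/
theorem vertexValue_add_edgeFunctional_sub_mem (e : E) :
    G.vertexValue (G.tail e) + G.edgeFunctional e - G.vertexValue (G.head e) ∈ G.periods := by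
  classical
  refine ⟨G.vertexChain (G.tail e) + Pi.single e 1 + -G.vertexChain (G.head e), ?_, ?_⟩
  · rw [mem_integralCycles_iff]
    simp [vertexChain, boundary_chain, boundary_single]
  · rw [integralFunctional_add, integralFunctional_add, integralFunctional_neg, sub_eq_add_neg]
    congr!

/-- The map from the realization to the Jacobian that is affine in arc length on every edge `e`
with direction `∫_e / ℓ(e)`. -/
noncomputable def potential : G.Curve → G.Jacobian :=
  G.curveLift (fun x => QuotientAddGroup.mk (G.vertexValue x))
    (fun e t => QuotientAddGroup.mk (G.vertexValue (G.tail e) + t • G.direction e))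
    (fun e => by simp)
    (fun e => by
      rw [len_smul_direction, ← sub_eq_zero, ← QuotientAddGroup.mk_sub,
        QuotientAddGroup.eq_zero_iff]
      exact G.vertexValue_add_edgeFunctional_sub_mem e)

theorem potential_point (e : E) {t : ℝ} (ht : t ∈ Icc 0 (G.len e)) :
    G.potential (G.point e t) =
      QuotientAddGroup.mk (G.vertexValue (G.tail e) + t • G.direction e) :=
  G.curveLift_point _ _ e ht

theorem continuous_potential : Continuous G.potential :=
  G.continuous_curveLift _ _ fun e => by
    have h : Continuous (QuotientAddGroup.mk : G.HarmonicDual → G.Jacobian) :=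
      continuous_quotient_mk'
    exact h.comp (by fun_prop)

end Functionals

/-! ### Path functionals in a refinement as differences of the potential -/

namespace Subdivision

variable {G} (S : G.Subdivision)

theorem left_mem (a : S.Edge) : (a.2 : ℝ) ∈ Icc 0 (G.len a.1) := by
  refine ⟨?_, (S.lt_len a.2.2).le⟩
  rcases Finset.mem_insert.1 a.2.2 with h | h
  · exact h.ge
  · exact (S.pts_mem _ _ h).1.le

theorem next_mem_insert (a : S.Edge) : S.next a ∈ insert (G.len a.1) (S.pts a.1) :=
  (Finset.mem_filter.1 (Finset.min'_mem _ (S.nonempty_later a))).1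

theorem next_mem (a : S.Edge) : S.next a ∈ Icc 0 (G.len a.1) := by
  refine ⟨(S.left_mem a).1.trans (S.lt_next a).le, ?_⟩
  rcases Finset.mem_insert.1 (S.next_mem_insert a) with h | h
  · exact h.le
  · exact (S.pts_mem _ _ h).2.le

theorem Icc_subset (a : S.Edge) : Icc (a.2 : ℝ) (S.next a) ⊆ Icc 0 (G.len a.1) :=
  Icc_subset_Icc (S.left_mem a).1 (S.next_mem a).2

theorem place_vertexAt (e : E) {t : ℝ} (ht : t = 0 ∨ t = G.len e ∨ t ∈ S.pts e) :
    S.place (S.vertexAt e t) = G.point e t := by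
  rcases ht with rfl | rfl | h
  · rw [vertexAt_zero, point_zero, place]
  · rw [vertexAt_len, point_len, place]
  · rw [S.vertexAt_of_mem h, place]

theorem place_edgeTail (a : S.Edge) : S.place (S.edgeTail a) = G.point a.1 a.2 :=
  S.place_vertexAt _ ((Finset.mem_insert.1 a.2.2).imp id Or.inr)

theorem place_edgeHead (a : S.Edge) : S.place (S.edgeHead a) = G.point a.1 (S.next a) :=
  S.place_vertexAt _ (Or.inr (Finset.mem_insert.1 (S.next_mem_insert a)))

/-- Both ends of `a` lie on one edge of `G`, where the potential has a single affine formula, so the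
vertex value cancels in the difference. -/
theorem mk_chainFunctional_single [Fintype E] {_ : DecidableEq S.Edge} (a : S.Edge) (n : ℤ) :
    (QuotientAddGroup.mk (S.chainFunctional (Pi.single a n)) : G.Jacobian) =
      n • (G.potential (S.place (S.edgeHead a)) - G.potential (S.place (S.edgeTail a))) := by
  rw [place_edgeHead, place_edgeTail, G.potential_point _ (S.left_mem a),
    G.potential_point _ (S.next_mem a), ← QuotientAddGroup.mk_sub, ← QuotientAddGroup.mk_zsmul,
    chainFunctional_single, add_sub_add_left_eq_sub, ← sub_smul, ← Int.cast_smul_eq_zsmul ℝ,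
    smul_smul]

/-- The differences of the potential along consecutive edges telescope. -/
theorem mk_chainFunctional_chain [Fintype E] {x y : S.Vert}
    (P : EdgePath S.graph.tail S.graph.head x y) :
    (QuotientAddGroup.mk (S.chainFunctional P.chain) : G.Jacobian) =
      G.potential (S.place y) - G.potential (S.place x) := by
  induction P with
  | nil x => simp [EdgePath.chain]
  | forward a hx hy P ih =>
    subst hx hy
    rw [EdgePath.chain, map_add, QuotientAddGroup.mk_add, ih, mk_chainFunctional_single, one_smul]
    simp only [graph]
    abel
  | backward a hx hy P ih =>
    subst hx hy
    rw [EdgePath.chain, map_add, QuotientAddGroup.mk_add, ih, mk_chainFunctional_single,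
      neg_one_smul]
    simp only [graph]
    abel

end Subdivision

/-! ### The Abel–Jacobi map in terms of the potential -/

section AbelJacobi

variable [Fintype E]

/-- The right-hand side does not mention `c`: this is the independence of refinement and path. -/
theorem mk_functional {p q : G.Curve} (c : G.Connection p q) :
    (QuotientAddGroup.mk c.functional : G.Jacobian) = G.potential q - G.potential p := by
  rw [c.functional_eq, c.sub.mk_chainFunctional_chain c.path, c.place_start, c.place_finish]

theorem abelJacobi_eq (p q : G.Curve) : G.abelJacobi p q = G.potential q - G.potential p :=
  G.mk_functional _

theorem continuous_abelJacobi (p : G.Curve) : Continuous (G.abelJacobi p) := by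
  rw [funext (G.abelJacobi_eq p)]
  exact G.continuous_potential.sub continuous_const

theorem exists_abelJacobi_point (p : G.Curve) (e : E) :
    ∃ w : G.HarmonicDual, ∀ t ∈ Icc 0 (G.len e),
      G.abelJacobi p (G.point e t) = QuotientAddGroup.mk (w + t • G.direction e) := by
  obtain ⟨c, hc⟩ := QuotientAddGroup.mk_surjective (G.potential p)
  refine ⟨G.vertexValue (G.tail e) - c, fun t ht => ?_⟩
  rw [abelJacobi_eq, G.potential_point e ht, ← hc, ← QuotientAddGroup.mk_sub]
  congr 1
  abel

end AbelJacobi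

end WeightedGraph

namespace WeightedGraph

variable {V : Type u} {E : Type v} (G : WeightedGraph V E)

/-! ### Bridges -/

section Bridges

/-- Adjacency in the graph with the edge `e` removed. -/
def AdjAvoiding (e : E) (x y : V) : Prop :=
  ∃ e', e' ≠ e ∧ (G.tail e' = x ∧ G.head e' = y ∨ G.head e' = x ∧ G.tail e' = y)

/-- The endpoints of `e` are connected in the graph with the edge `e` removed. -/
def HasDetour (e : E) : Prop :=
  Relation.ReflTransGen (G.AdjAvoiding e) (G.tail e) (G.head e)

variable {G}

theorem AdjAvoiding.symm {e : E} {x y : V} (h : G.AdjAvoiding e x y) : G.AdjAvoiding e y x := by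
  obtain ⟨e', he', h | h⟩ := h
  exacts [⟨e', he', Or.inr ⟨h.2, h.1⟩⟩, ⟨e', he', Or.inl ⟨h.2, h.1⟩⟩]

instance (e : E) : Std.Symm (G.AdjAvoiding e) := ⟨fun _ _ h => h.symm⟩

open scoped Classical in
theorem exists_chain_avoiding [Fintype E] {e : E} {x y : V}
    (h : Relation.ReflTransGen (G.AdjAvoiding e) x y) :
    ∃ α : E → ℤ, α e = 0 ∧ G.boundary α = Pi.single y 1 - Pi.single x 1 := by
  induction h with
  | refl => exact ⟨0, rfl, by simp⟩
  | tail _ hyz ih =>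
    obtain ⟨α, h0, h1⟩ := ih
    obtain ⟨e', he', ⟨rfl, rfl⟩ | ⟨rfl, rfl⟩⟩ := hyz
    · refine ⟨α + Pi.single e' 1, by simp [h0, he'.symm], ?_⟩
      rw [map_add, h1, boundary_single]
      abel
    · refine ⟨α - Pi.single e' 1, by simp [h0, he'.symm], ?_⟩
      rw [map_sub, h1, boundary_single]
      abel

/-- Close up `e` by the detour; as the detour avoids `e`, the coefficient at `e` remains 1. -/
theorem HasDetour.exists_cycle [Fintype E] {e : E} (h : G.HasDetour e) :
    ∃ β ∈ G.integralCycles, β e = 1 := by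
  classical
  obtain ⟨α, h0, h1⟩ := exists_chain_avoiding h
  refine ⟨Pi.single e 1 - α, ?_, by simp [h0]⟩
  rw [mem_integralCycles_iff, map_sub, boundary_single]
  convert sub_self _

/-- Summation by parts: grouping the edges by head and by tail, harmonicity makes the two sums agree
vertex by vertex. -/
theorem sum_mul_sub_eq_zero [Finite V] [Fintype E] (ω : G.harmonicForms) (f : V → ℝ) :
    ∑ e, (ω : E → ℝ) e * (f (G.head e) - f (G.tail e)) = 0 := by
  classical
  have := Fintype.ofFinite V
  have key : ∀ g : E → V, ∑ e, (ω : E → ℝ) e * f (g e) =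
      ∑ x, (∑ e with g e = x, (ω : E → ℝ) e) * f x := by
    intro g
    rw [← Finset.sum_fiberwise (s := Finset.univ) (g := g)]
    refine Finset.sum_congr rfl fun x _ => ?_
    rw [Finset.sum_mul]
    refine Finset.sum_congr rfl fun e he => ?_
    rw [(Finset.mem_filter.1 he).2]
  simp only [mul_sub, Finset.sum_sub_distrib]
  rw [key, key, sub_eq_zero]
  refine Finset.sum_congr rfl fun x _ => ?_
  congr 1
  convert ω.2 x

/-- The indicator function `f` of the component of the tail in the graph without `e` jumps only
across `e`. In the summation by parts only the term $-\omega_e$ survives. -/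
theorem edgeFunctional_eq_zero [Finite V] [Fintype E] {e : E} (h : ¬ G.HasDetour e) :
    G.edgeFunctional e = 0 := by
  classical
  ext ω
  let f : V → ℝ := fun x => if Relation.ReflTransGen (G.AdjAvoiding e) (G.tail e) x then 1 else 0
  have hs := sum_mul_sub_eq_zero ω f
  rw [Finset.sum_eq_single e] at hs
  · have h0 : f (G.head e) = 0 := if_neg h
    have h1 : f (G.tail e) = 1 := if_pos .refl
    rw [h0, h1] at hs
    have : (ω : E → ℝ) e = 0 := by linarith
    rw [edgeFunctional_apply, this, zero_mul, HarmonicDual.zero_apply]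
  · intro e' _ he'
    have : f (G.head e') = f (G.tail e') := by
      simp only [f]
      congr 1
      apply propext
      exact ⟨fun h => h.tail ⟨e', he', Or.inr ⟨rfl, rfl⟩⟩,
        fun h => h.tail ⟨e', he', Or.inl ⟨rfl, rfl⟩⟩⟩
    rw [this, sub_self, mul_zero]
  · exact fun h => absurd (Finset.mem_univ e) h

theorem HasDetour.edgeFunctional_ne_zero [Fintype E] {e : E} (h : G.HasDetour e) :
    G.edgeFunctional e ≠ 0 := by
  obtain ⟨β, hβ, h1⟩ := h.exists_cycle
  intro h0
  have := congrArg (fun φ : G.HarmonicDual => φ (G.cycleForm β hβ)) h0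
  simp only [edgeFunctional_apply, cycleForm_apply, h1, HarmonicDual.zero_apply] at this
  simp [(G.len_pos e).ne'] at this

/-- A cycle with coefficient 1 at `e` is an integral form on which the direction takes the value 1,
whereas `t • μ` takes a multiple of `t` there. -/
theorem isPrimitiveIn_direction [Finite V] [Fintype E] {e : E} (h : G.edgeFunctional e ≠ 0) :
    IsPrimitiveIn G.integralDual (G.direction e) := by
  refine ⟨G.direction_mem_integralDual e, fun μ hμ t ht heq => ?_⟩
  obtain ⟨β, hβ, h1⟩ := (not_imp_comm.1 edgeFunctional_eq_zero h).exists_cycle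
  obtain ⟨m, hm⟩ := hμ (G.cycleForm β hβ) fun e => ⟨β e, rfl⟩
  have := congrArg (HarmonicDual.eval (G.cycleForm β hβ)) heq
  rw [map_zsmul] at this
  change G.direction e _ = t • μ _ at this
  rw [direction_apply, cycleForm_apply, h1, hm, zsmul_eq_mul] at this
  have hi : t * m = 1 := by exact_mod_cast this.symm
  rcases Int.eq_one_or_neg_one_of_mul_eq_one hi with h | h <;> omega

end Bridges

/-! ### Complements of open edges -/

section Complement

/-- The function on the realization that interpolates a function on the vertices linearly. -/
noncomputable def interpolate (f : V → ℝ) : G.Curve → ℝ :=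
  G.curveLift f (fun e t => f (G.tail e) + t * ((f (G.head e) - f (G.tail e)) / G.len e))
    (fun e => by simp) (fun e => by rw [mul_div_cancel₀ _ (G.len_pos e).ne']; ring)

theorem continuous_interpolate (f : V → ℝ) : Continuous (G.interpolate f) :=
  G.continuous_curveLift _ _ fun e => by fun_prop

theorem interpolate_vertexPoint (f : V → ℝ) (x : V) :
    G.interpolate f (G.vertexPoint x) = f x := rfl

theorem interpolate_point (f : V → ℝ) (e : E) {t : ℝ} (ht : t ∈ Icc 0 (G.len e)) :
    G.interpolate f (G.point e t) =
      f (G.tail e) + t * ((f (G.head e) - f (G.tail e)) / G.len e) :=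
  G.curveLift_point _ _ e ht

theorem normalForm_vertexPoint (x : V) : G.normalForm (G.vertexPoint x) = Sum.inl x := rfl

theorem normalForm_point_of_mem_Ioo (e : E) {t : ℝ} (ht : t ∈ Ioo 0 (G.len e)) :
    G.normalForm (G.point e t) = Sum.inr (e, t) := by
  rw [G.normalForm_point e (Ioo_subset_Icc_self ht), if_neg ht.1.ne', if_neg ht.2.ne]

theorem vertexPoint_notMem_openSegment (e : E) (x : V) : G.vertexPoint x ∉ G.openSegment e := by
  rintro ⟨t, ht, h⟩
  have := congrArg G.normalForm h
  rw [G.normalForm_point_of_mem_Ioo e ht] at this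
  cases this

theorem point_notMem_openSegment {e e' : E} (h : e' ≠ e) {t : ℝ} (ht : t ∈ Icc 0 (G.len e')) :
    G.point e' t ∉ G.openSegment e := by
  rintro ⟨s, hs, h'⟩
  have := congrArg G.normalForm h'
  rw [G.normalForm_point_of_mem_Ioo e hs, G.normalForm_point e' ht] at this
  split_ifs at this
  exact h (congrArg Prod.fst (Sum.inr.inj this)).symm

variable {G}

/-- The indicator function of the vertices reachable from the tail without `e`, interpolated
linearly, is continuous and takes only the values 0 and 1 off the open edge. Connectedness makes it
constant there, so it agrees at tail and head. -/
theorem hasDetour_of_isConnected {e : E} (h : IsConnected (G.openSegment e)ᶜ) :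
    G.HasDetour e := by
  classical
  let f : V → ℝ := fun x => if Relation.ReflTransGen (G.AdjAvoiding e) (G.tail e) x then 1 else 0
  have hf : ∀ x, f x ∈ ({0, 1} : Set ℝ) := fun x => by
    simp only [f]
    split_ifs <;> simp
  have hmaps : MapsTo (G.interpolate f) (G.openSegment e)ᶜ ({0, 1} : Set ℝ) := by
    intro q hq
    rcases G.exists_rep q with ⟨x, rfl⟩ | ⟨e', t, ht, rfl⟩
    · exact hf x
    · have hne : e' ≠ e := by
        rintro rfl
        exact hq ⟨t, ht, rfl⟩
      -- The edge `e'` itself joins its endpoints while avoiding `e`, so the interpolation is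
      -- constant along it.
      have : f (G.head e') = f (G.tail e') := by
        simp only [f]
        congr 1
        apply propext
        exact ⟨fun h => h.tail ⟨e', hne, Or.inr ⟨rfl, rfl⟩⟩,
          fun h => h.tail ⟨e', hne, Or.inl ⟨rfl, rfl⟩⟩⟩
      rw [G.interpolate_point f e' (Ioo_subset_Icc_self ht), this]
      simpa using hf (G.tail e')
  have heq := h.isPreconnected.constant_of_mapsTo (Set.toFinite {0, 1}).isDiscrete (G.continuous_interpolate f).continuousOn hmaps
    (G.vertexPoint_notMem_openSegment e (G.tail e)) (G.vertexPoint_notMem_openSegment e (G.head e))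
  rw [interpolate_vertexPoint, interpolate_vertexPoint] at heq
  by_contra hd
  have h0 : f (G.head e) = 0 := if_neg hd
  have h1 : f (G.tail e) = 1 := if_pos .refl
  rw [h0, h1] at heq
  exact one_ne_zero heq

theorem joinedIn_tail_point {e e' : E} (h : e' ≠ e) {t : ℝ} (ht : t ∈ Icc 0 (G.len e')) :
    JoinedIn (G.openSegment e)ᶜ (G.vertexPoint (G.tail e')) (G.point e' t) := by
  have hc : IsPathConnected (Icc 0 (G.len e')) :=
    (convex_Icc _ _).isPathConnected (nonempty_Icc.2 (G.len_pos e').le)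
  have := (hc.image (G.continuous_point e')).joinedIn (G.vertexPoint (G.tail e'))
    ⟨0, ⟨le_rfl, (G.len_pos e').le⟩, G.point_zero e'⟩ (G.point e' t) ⟨t, ht, rfl⟩
  refine this.mono ?_
  rintro _ ⟨s, hs, rfl⟩
  exact G.point_notMem_openSegment h hs

theorem joinedIn_tail_head {e e' : E} (h : e' ≠ e) :
    JoinedIn (G.openSegment e)ᶜ (G.vertexPoint (G.tail e')) (G.vertexPoint (G.head e')) := by
  rw [← G.point_len]
  exact joinedIn_tail_point h ⟨(G.len_pos e').le, le_rfl⟩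

theorem joinedIn_of_reflTransGen {e : E} {x y : V}
    (h : Relation.ReflTransGen (G.AdjAvoiding e) x y) :
    JoinedIn (G.openSegment e)ᶜ (G.vertexPoint x) (G.vertexPoint y) := by
  induction h with
  | refl => exact JoinedIn.refl (G.vertexPoint_notMem_openSegment e x)
  | tail _ h ih =>
    obtain ⟨e', he', ⟨rfl, rfl⟩ | ⟨rfl, rfl⟩⟩ := h
    · exact ih.trans (joinedIn_tail_head he')
    · exact ih.trans (joinedIn_tail_head he').symm

/-- Each traversal of `e` in the path can be replaced by the detour, in the appropriate direction.
-/
theorem HasDetour.reflTransGen {e : E} (h : G.HasDetour e) {x y : V}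
    (P : EdgePath G.tail G.head x y) : Relation.ReflTransGen (G.AdjAvoiding e) x y := by
  induction P with
  | nil => exact .refl
  | forward e' hx hy P ih =>
    by_cases he : e' = e
    · subst he hx hy
      exact Relation.ReflTransGen.trans h ih
    · exact ih.head ⟨e', he, Or.inl ⟨hx, hy⟩⟩
  | backward e' hx hy P ih =>
    by_cases he : e' = e
    · subst he hx hy
      exact (symm (r := Relation.ReflTransGen (G.AdjAvoiding e')) h).trans ih
    · exact ih.head ⟨e', he, Or.inr ⟨hx, hy⟩⟩

theorem HasDetour.isConnected {e : E} (h : G.HasDetour e) : IsConnected (G.openSegment e)ᶜ := by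
  refine IsPathConnected.isConnected ⟨G.vertexPoint (G.tail e),
    G.vertexPoint_notMem_openSegment e _, fun {q} hq => ?_⟩
  have hv : ∀ x, JoinedIn (G.openSegment e)ᶜ (G.vertexPoint (G.tail e)) (G.vertexPoint x) :=
    fun x => joinedIn_of_reflTransGen (h.reflTransGen (G.connected _ x).some)
  rcases G.exists_rep q with ⟨x, rfl⟩ | ⟨e', t, ht, rfl⟩
  · exact hv x
  · refine (hv (G.tail e')).trans (joinedIn_tail_point ?_ (Ioo_subset_Icc_self ht))
    rintro rfl
    exact hq ⟨t, ht, rfl⟩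

theorem exists_abelJacobi_image_segment_eq [Finite V] [Fintype E] (p : G.Curve) {e : E}
    (h : ¬ IsConnected (G.openSegment e)ᶜ) :
    ∃ z : G.Jacobian, G.abelJacobi p '' G.segment e = {z} := by
  have h0 : G.direction e = 0 := by
    rw [direction, edgeFunctional_eq_zero fun hd => h hd.isConnected, smul_zero]
  obtain ⟨w, hw⟩ := G.exists_abelJacobi_point p e
  refine ⟨QuotientAddGroup.mk w, Subset.antisymm ?_ ?_⟩
  · rintro _ ⟨_, ⟨t, ht, rfl⟩, rfl⟩
    rw [hw t ht, h0, smul_zero, add_zero]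
    rfl
  · rintro _ rfl
    have hm : (0 : ℝ) ∈ Icc 0 (G.len e) := ⟨le_rfl, (G.len_pos e).le⟩
    exact ⟨_, ⟨0, hm, rfl⟩, by rw [hw 0 hm, zero_smul, add_zero]⟩

end Complement

end WeightedGraph

namespace WeightedGraph

variable {V : Type u} {E : Type v} (G : WeightedGraph V E)

/-! ### Topology of the realization and its subgraphs -/

section Separation

open scoped Classical in
/-- A function that is supported on the segment `e`, where it is given by a function vanishing at
the endpoints. -/
noncomputable def bump (e : E) (g : ℝ → ℝ) (h0 : g 0 = 0) (h1 : g (G.len e) = 0) : G.Curve → ℝ :=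
  G.curveLift (fun _ => 0) (fun e' t => if e' = e then g t else 0)
    (fun e' => by simp [h0]) (fun e' => by simp +contextual [h1])

variable (e : E) {g : ℝ → ℝ} (h0 : g 0 = 0) (h1 : g (G.len e) = 0)

theorem continuous_bump (hg : Continuous g) : Continuous (G.bump e g h0 h1) :=
  G.continuous_curveLift _ _ fun e' => by
    split_ifs
    exacts [hg, continuous_const]

theorem bump_vertexPoint (x : V) : G.bump e g h0 h1 (G.vertexPoint x) = 0 := rfl

theorem bump_point_self {t : ℝ} (ht : t ∈ Icc 0 (G.len e)) :
    G.bump e g h0 h1 (G.point e t) = g t := by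
  rw [bump, G.curveLift_point _ _ e ht, if_pos rfl]

theorem bump_point_of_ne {e' : E} (h : e' ≠ e) {t : ℝ} (ht : t ∈ Icc 0 (G.len e')) :
    G.bump e g h0 h1 (G.point e' t) = 0 := by
  rw [bump, G.curveLift_point _ _ e' ht, if_neg h]

open scoped Classical in
/-- Coordinates separating the points of the realization. -/
noncomputable def coordinates (q : G.Curve) : (V → ℝ) × (E → ℝ) × (E → ℝ) :=
  (fun x => G.interpolate (Pi.single x 1) q,
    fun e => G.bump e (fun t => t * (G.len e - t)) (by simp) (by simp) q,
    fun e => G.bump e (fun t => t * (t * (G.len e - t))) (by simp) (by simp) q)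

theorem continuous_coordinates : Continuous G.coordinates := by
  refine (continuous_pi fun x => G.continuous_interpolate _).prodMk
    ((continuous_pi fun e => ?_).prodMk (continuous_pi fun e => ?_))
  all_goals exact G.continuous_bump _ _ _ (by fun_prop)

/-- The first family separates vertices. The value $t(\ell(e)-t)$ is positive exactly in the
interior of `e`, so it identifies the edge, and the quotient of the third family by the second
recovers $t$. -/
theorem coordinates_injective : Function.Injective G.coordinates := by
  classical
  intro p q h
  simp only [coordinates, Prod.mk.injEq, funext_iff] at h
  obtain ⟨h1, h2, h3⟩ := h
  rcases G.exists_rep p with ⟨x, rfl⟩ | ⟨e, t, ht, rfl⟩ <;>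
    rcases G.exists_rep q with ⟨y, rfl⟩ | ⟨e', t', ht', rfl⟩
  · have := h1 x
    simp only [interpolate_vertexPoint, Pi.single_apply] at this
    by_cases hxy : y = x
    · rw [hxy]
    · simp [hxy] at this
  · have := h2 e'
    rw [bump_vertexPoint, bump_point_self _ _ _ _ (Ioo_subset_Icc_self ht')] at this
    exact absurd this (mul_pos ht'.1 (sub_pos.2 ht'.2)).ne
  · have := h2 e
    rw [bump_vertexPoint, bump_point_self _ _ _ _ (Ioo_subset_Icc_self ht)] at this
    exact absurd this (mul_pos ht.1 (sub_pos.2 ht.2)).ne'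
  · have hpos := mul_pos ht.1 (sub_pos.2 ht.2)
    have h2e := h2 e
    rw [bump_point_self _ _ _ _ (Ioo_subset_Icc_self ht)] at h2e
    by_cases hee : e' = e
    · subst hee
      have h3e := h3 e'
      rw [bump_point_self _ _ _ _ (Ioo_subset_Icc_self ht)] at h3e
      rw [bump_point_self _ _ _ _ (Ioo_subset_Icc_self ht')] at h2e h3e
      rw [← h2e] at h3e
      rw [mul_right_cancel₀ hpos.ne' h3e]
    · rw [bump_point_of_ne _ _ _ _ hee (Ioo_subset_Icc_self ht')] at h2e
      exact absurd h2e hpos.ne'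

/-- Hausdorffness makes a continuous surjection from a compact space onto a subgraph a quotient map.
-/
instance : T2Space G.Curve :=
  T2Space.of_injective_continuous G.coordinates_injective G.continuous_coordinates

end Separation

variable {G}

/-- A subgraph is a quotient of a finite disjoint union of compact intervals, and local path
connectedness passes to quotients. -/
theorem IsSubgraph.locallyPathConnectedSpace [Finite V] [Finite E] {X : Set G.Curve}
    (hX : G.IsSubgraph X) : LocallyPathConnectedSpace X := by
  obtain ⟨S, A, B, rfl⟩ := hX
  -- Isolated vertices are covered by constant paths, so that all pieces share the same parameter
  -- space.
  let c : (i : A ⊕ B) → unitInterval → G.Curve := fun i t => match i with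
    | Sum.inl a => S.place a
    | Sum.inr b => G.point b.1.1 (AffineMap.lineMap (b.1.2 : ℝ) (S.next b.1) (t : ℝ))
  have hc : ∀ i, Continuous (c i) := by
    rintro (a | b)
    · exact continuous_const
    · exact (G.continuous_point _).comp
        (AffineMap.lineMap_continuous.comp continuous_subtype_val)
  have himage : ∀ b : S.Edge, (fun t : ℝ => AffineMap.lineMap (b.2 : ℝ) (S.next b) t) '' Icc 0 1 =
      Icc (b.2 : ℝ) (S.next b) := fun b => by
    rw [← segment_eq_Icc (S.lt_next b).le, segment_eq_image_lineMap]
  let φ : (Σ _ : A ⊕ B, unitInterval) → ↥(S.place '' A ∪ ⋃ a ∈ B, S.subsegment a) :=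
    fun s => ⟨c s.1 s.2, by
      rcases s with ⟨a | b, t⟩
      · exact Or.inl ⟨a, a.2, rfl⟩
      · refine Or.inr (mem_iUnion₂.2 ⟨b, b.2, _, ?_, rfl⟩)
        rw [← himage b]
        exact ⟨t, t.2, rfl⟩⟩
  have hφ : Continuous φ := (continuous_sigma hc).subtype_mk _
  have hsurj : Function.Surjective φ := by
    rintro ⟨q, ⟨a, ha, rfl⟩ | hq⟩
    · exact ⟨⟨Sum.inl ⟨a, ha⟩, 0⟩, rfl⟩
    · obtain ⟨b, hb, s, hs, rfl⟩ := mem_iUnion₂.1 hq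
      rw [← himage b] at hs
      obtain ⟨t, ht, rfl⟩ := hs
      exact ⟨⟨Sum.inr ⟨b, hb⟩, ⟨t, ht⟩⟩, rfl⟩
  have : LocallyPathConnectedSpace unitInterval := (convex_Icc 0 1).locallyPathConnectedSpace
  exact (IsQuotientMap.of_surjective_continuous hsurj hφ).locallyPathConnectedSpace

/-! ### Discreteness of the period lattice -/

section Lattice

variable [Fintype E]

/-- Pair the cycle `α` with itself as a harmonic form. If $M\ge1$ is its largest absolute
coefficient, attained at `e`, the pairing is at least $M^2\ell(e)$, while the form has sup norm at
most $M$; hence the functional has norm at least $M\ell(e)$. -/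
theorem le_norm_of_mem_periods {ε : ℝ} (hε : ∀ e, ε ≤ G.len e) {φ : G.HarmonicDual}
    (hφ : φ ∈ G.periods) (h0 : φ ≠ 0) : ε ≤ ‖φ‖ := by
  obtain ⟨α, hα, rfl⟩ := hφ
  obtain ⟨e₀, he₀⟩ : ∃ e, α e ≠ 0 := by
    by_contra! h
    apply h0
    ext ω
    simp [integralFunctional_apply, h]
  have : Nonempty E := ⟨e₀⟩
  obtain ⟨e, he⟩ := Finite.exists_max fun e => |(α e : ℝ)|
  have hM : 1 ≤ |(α e : ℝ)| := by
    refine le_trans ?_ (he e₀)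
    exact_mod_cast Int.one_le_abs he₀
  have hω : ‖G.cycleForm α hα‖ ≤ |(α e : ℝ)| :=
    (pi_norm_le_iff_of_nonneg (abs_nonneg _)).2 he
  have h1 : ‖G.integralFunctional α (G.cycleForm α hα)‖ ≤
      ‖G.integralFunctional α‖ * ‖G.cycleForm α hα‖ :=
    ContinuousLinearMap.le_opNorm (G.integralFunctional α : StrongDual ℝ G.harmonicForms) _
  have h2 : |(α e : ℝ)| * |(α e : ℝ)| * G.len e ≤
      G.integralFunctional α (G.cycleForm α hα) := by
    rw [integralFunctional_apply, abs_mul_abs_self]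
    exact Finset.single_le_sum (f := fun e => (α e : ℝ) * (α e : ℝ) * G.len e)
      (fun e _ => mul_nonneg (mul_self_nonneg _) (G.len_pos e).le) (Finset.mem_univ e)
  have h3 : |(α e : ℝ)| * G.len e * |(α e : ℝ)| ≤
      ‖G.integralFunctional α‖ * |(α e : ℝ)| := by
    calc _ = |(α e : ℝ)| * |(α e : ℝ)| * G.len e := by ring
      _ ≤ _ := h2.trans ((le_abs_self _).trans h1)
      _ ≤ _ := mul_le_mul_of_nonneg_left hω (norm_nonneg _)
  calc ε ≤ G.len e := hε e
    _ ≤ |(α e : ℝ)| * G.len e := le_mul_of_one_le_left (G.len_pos e).le hM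
    _ ≤ _ := le_of_mul_le_mul_right h3 (by linarith)

instance : DiscreteTopology G.periods := by
  obtain ⟨ε, hε0, hε⟩ : ∃ ε > 0, ∀ e, ε ≤ G.len e := by
    cases isEmpty_or_nonempty E
    · exact ⟨1, one_pos, fun e => isEmptyElim e⟩
    · obtain ⟨e, he⟩ := Finite.exists_min G.len
      exact ⟨G.len e, G.len_pos e, he⟩
  refine discreteTopology_of_isOpen_singleton_zero (Metric.isOpen_singleton_iff.2
    ⟨ε, hε0, fun φ hφ => ?_⟩)
  by_contra h0
  rw [dist_zero_right] at hφ
  exact absurd hφ (not_lt.2 (le_norm_of_mem_periods hε φ.2 fun h => h0 (Subtype.ext h)))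

variable (G) in
theorem isCoveringMap_mk :
    IsCoveringMap (QuotientAddGroup.mk : G.HarmonicDual → G.Jacobian) :=
  (AddSubgroup.isAddQuotientCoveringMap_of_comm G.periods
    (SetLike.isDiscrete_iff_discreteTopology.2 inferInstance)).isCoveringMap

end Lattice

/-! ### Lifts of the Abel-Jacobi map -/

section Lifts

variable [Fintype E]

/-- This is the lifting criterion for coverings; the value 0 is allowed at `p` because
$\Phi_p(p)=0$. -/
theorem existsUnique_isLift [Finite V] (p : G.Curve) {X : Set G.Curve} (hX : G.IsSubgraph X)
    [SimplyConnectedSpace X] (hp : p ∈ X) :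
    ∃! F : X → G.HarmonicDual, G.IsLift p X F ∧ F ⟨p, hp⟩ = 0 := by
  have := hX.locallyPathConnectedSpace
  obtain ⟨F, ⟨h1, h2⟩, h3⟩ := G.isCoveringMap_mk.existsUnique_continuousMap_lifts
    (⟨fun x : X => G.abelJacobi p x, (G.continuous_abelJacobi p).comp continuous_subtype_val⟩)
    ⟨p, hp⟩ (0 : G.HarmonicDual) (by simp [abelJacobi_eq])
  refine ⟨F, ⟨⟨F.continuous, fun x => congrFun h2 x⟩, h1⟩, fun F' hF' => ?_⟩
  have := h3 ⟨F', hF'.1.1⟩ ⟨hF'.2, funext hF'.1.2⟩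
  exact congrArg DFunLike.coe this

theorem IsLift.exists_point_eq {p : G.Curve} {X : Set G.Curve} {F : X → G.HarmonicDual}
    (hF : G.IsLift p X F) {e : E} (he : G.segment e ⊆ X) :
    ∃ a : G.HarmonicDual, ∀ t (ht : t ∈ Icc 0 (G.len e)),
      F ⟨G.point e t, he ⟨t, ht, rfl⟩⟩ = a + t • G.direction e := by
  obtain ⟨w, hw⟩ := G.exists_abelJacobi_point p e
  have := isPreconnected_iff_preconnectedSpace.1 (isPreconnected_Icc (a := (0 : ℝ)) (b := G.len e))
  -- The lift and the affine map project to the same map, so their difference is a continuous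
  -- function from an interval to the discrete group of periods, hence constant.
  let d : Icc 0 (G.len e) → G.periods := fun t =>
    ⟨F ⟨G.point e t, he ⟨t, t.2, rfl⟩⟩ - (w + (t : ℝ) • G.direction e), by
      rw [← QuotientAddGroup.eq_zero_iff, QuotientAddGroup.mk_sub, hF.2, hw t t.2, sub_self]⟩
  have hd : Continuous d := by
    refine Continuous.subtype_mk (Continuous.sub (hF.1.comp ?_) (by fun_prop)) _
    exact ((G.continuous_point e).comp continuous_subtype_val).subtype_mk _
  have h0 : (0 : ℝ) ∈ Icc 0 (G.len e) := ⟨le_rfl, (G.len_pos e).le⟩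
  refine ⟨w + d ⟨0, h0⟩, fun t ht => ?_⟩
  have := congrArg Subtype.val (PreconnectedSpace.constant ‹_› hd (x := ⟨t, ht⟩) (y := ⟨0, h0⟩))
  rw [add_right_comm, ← this]
  exact (add_sub_cancel _ _).symm

theorem IsLift.image_segment {p : G.Curve} {X : Set G.Curve} {F : X → G.HarmonicDual}
    (hF : G.IsLift p X F) {e : E} (hc : IsConnected (G.openSegment e)ᶜ) (he : G.segment e ⊆ X) :
    ∃ a b : G.HarmonicDual, a ≠ b ∧
      F '' {x : X | (x : G.Curve) ∈ G.segment e} = _root_.segment ℝ a b ∧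
      ∀ (t : ℝ) (x : X), t ∈ Set.Icc 0 (G.len e) → (x : G.Curve) = G.point e t →
        F x = AffineMap.lineMap a b (t / G.len e) := by
  obtain ⟨a, ha⟩ := hF.exists_point_eq he
  have hl := G.len_pos e
  have hline : ∀ t : ℝ, AffineMap.lineMap a (a + G.edgeFunctional e) (t / G.len e) =
      a + t • G.direction e := by
    intro t
    rw [AffineMap.lineMap_apply_module', add_sub_cancel_left, ← len_smul_direction, smul_smul,
      div_mul_cancel₀ _ hl.ne', add_comm]
  -- The endpoints differ by $\int_e$, which is nonzero because `e` has a detour.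
  refine ⟨a, a + G.edgeFunctional e, ?_, ?_, ?_⟩
  · simpa using (hasDetour_of_isConnected hc).edgeFunctional_ne_zero
  · rw [segment_eq_image_lineMap]
    apply Subset.antisymm
    · rintro _ ⟨⟨_, hx⟩, ⟨t, ht, rfl⟩, rfl⟩
      refine ⟨t / G.len e, ⟨div_nonneg ht.1 hl.le, (div_le_one hl).2 ht.2⟩, ?_⟩
      rw [hline, ← ha t ht]
    · rintro _ ⟨s, hs, rfl⟩
      have ht : s * G.len e ∈ Icc 0 (G.len e) :=
        ⟨mul_nonneg hs.1 hl.le, mul_le_of_le_one_left hl.le hs.2⟩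
      refine ⟨⟨G.point e (s * G.len e), he ⟨_, ht, rfl⟩⟩, ⟨_, ht, rfl⟩, ?_⟩
      rw [ha _ ht, ← hline, mul_div_cancel_right₀ _ hl.ne']
  · rintro t ⟨_, hx⟩ ht rfl
    rw [hline, ← ha t ht]

end Lifts

end WeightedGraph

namespace WeightedGraph

variable {V : Type u} {E : Type v} {G : WeightedGraph V E}

/-! ### Tropicality -/

section Tropical

namespace UnitTangent

/-- The unit tangent vector at the tail of an edge. -/
def ofTail (G : WeightedGraph V E) (e : E) : G.UnitTangent where
  edge := e
  pos := 0
  pos_mem := ⟨le_rfl, (G.len_pos e).le⟩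
  forward := true
  forward_lt _ := G.len_pos e
  backward_lt h := nomatch h

/-- The unit tangent vector at the head of an edge. -/
def ofHead (G : WeightedGraph V E) (e : E) : G.UnitTangent where
  edge := e
  pos := G.len e
  pos_mem := ⟨(G.len_pos e).le, le_rfl⟩
  forward := false
  forward_lt h := nomatch h
  backward_lt _ := G.len_pos e

/-- The unit tangent vectors at an interior point of an edge. -/
def ofInterior (G : WeightedGraph V E) (e : E) {t : ℝ} (ht : t ∈ Ioo 0 (G.len e)) (b : Bool) :
    G.UnitTangent where
  edge := e
  pos := t
  pos_mem := Ioo_subset_Icc_self ht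
  forward := b
  forward_lt _ := ht.2
  backward_lt _ := ht.1

variable [Fintype E]

/-- The image of a unit tangent vector under the differential of the Abel-Jacobi map. -/
noncomputable def image (d : G.UnitTangent) : G.HarmonicDual :=
  if d.forward then G.direction d.edge else -G.direction d.edge

theorem image_mem_integralDual (d : G.UnitTangent) : d.image ∈ G.integralDual := by
  unfold image
  split_ifs
  exacts [G.direction_mem_integralDual _, neg_mem (G.direction_mem_integralDual _)]

theorem hasDifferential_abelJacobi (p : G.Curve) (d : G.UnitTangent) :
    G.HasDifferential G.periods (G.abelJacobi p) d d.image := by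
  obtain ⟨w, hw⟩ := G.exists_abelJacobi_point p d.edge
  have hderiv : ∀ v : G.HarmonicDual,
      HasDerivWithinAt (fun r : ℝ => w + d.pos • G.direction d.edge + r • v) v (Ici 0) 0 := by
    intro v
    simpa using (((hasDerivAt_id (0 : ℝ)).smul_const v).const_add
      (w + d.pos • G.direction d.edge)).hasDerivWithinAt
  -- This is the time until the flow reaches the end of the segment; it is positive because a unit
  -- tangent vector does not point out of its segment.
  refine ⟨if d.forward then G.len d.edge - d.pos else d.pos, ?_,
    fun r => w + d.pos • G.direction d.edge + r • d.image, by fun_prop, fun r hr => ?_, hderiv _⟩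
  · split_ifs with h
    · exact sub_pos.2 (d.forward_lt h)
    · exact d.backward_lt (by simpa using h)
  · rw [flow, image]
    have hp := d.pos_mem
    split_ifs at hr ⊢ with h
    · rw [hw _ ⟨add_nonneg hp.1 hr.1, by linarith [hr.2]⟩, add_smul, ← add_assoc]
    · rw [hw _ ⟨by linarith [hr.2], by linarith [hr.1, hp.2]⟩, sub_smul, ← add_sub_assoc,
        sub_eq_add_neg, ← smul_neg]

/-- Outgoing edges contribute their direction and incoming ones its negative, so evaluation at `ω`
gives the harmonicity condition at `x`. -/
theorem finsum_image_vertexPoint (x : V) :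
    ∑ᶠ d : {d : G.UnitTangent // d.base = G.vertexPoint x}, d.1.image = 0 := by
  classical
  -- The disjoint sum counts a loop at `x` twice, once for each of its two tangent vectors.
  let f : {e // G.tail e = x} ⊕ {e // G.head e = x} →
      {d : G.UnitTangent // d.base = G.vertexPoint x} :=
    Sum.elim (fun e => ⟨ofTail G e.1, by rw [base, ofTail, G.point_zero, e.2]⟩)
      (fun e => ⟨ofHead G e.1, by rw [base, ofHead, G.point_len, e.2]⟩)
  have hf : Function.Bijective f := by
    constructor
    · rintro (⟨e, rfl⟩ | ⟨e, he⟩) (⟨e', he'⟩ | ⟨e', he'⟩) h <;>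
        simpa [f, ofTail, ofHead] using congrArg (fun d => (d.1.edge, d.1.forward)) h
    · rintro ⟨⟨e, t, ht, b, h1, h2⟩, hd⟩
      have key := congrArg G.normalForm hd
      rw [base, G.normalForm_point e ht, normalForm_vertexPoint] at key
      cases b
      · have hpos := h2 rfl
        rw [if_neg hpos.ne'] at key
        split_ifs at key with h
        subst h
        exact ⟨Sum.inr ⟨e, Sum.inl.inj key⟩, rfl⟩
      · have hlt := h1 rfl
        rw [if_neg hlt.ne] at key
        split_ifs at key with h
        subst h
        exact ⟨Sum.inl ⟨e, Sum.inl.inj key⟩, rfl⟩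
  rw [← finsum_eq_of_bijective (f := fun i => (f i).1.image) f hf fun _ => rfl,
    finsum_eq_sum_of_fintype, Fintype.sum_sum_type]
  ext ω
  have hω : ∑ e with G.head e = x, (ω : E → ℝ) e = ∑ e with G.tail e = x, (ω : E → ℝ) e := by
    convert ω.2 x
  rw [← Finset.sum_subtype_eq_sum_filter, ← Finset.sum_subtype_eq_sum_filter] at hω
  simp only [Finset.subtype_univ] at hω
  simp [f, image, ofTail, ofHead, hω]

theorem finsum_image_of_mem_Ioo (e : E) {t : ℝ} (ht : t ∈ Ioo 0 (G.len e)) :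
    ∑ᶠ d : {d : G.UnitTangent // d.base = G.point e t}, d.1.image = 0 := by
  let f : Bool → {d : G.UnitTangent // d.base = G.point e t} :=
    fun b => ⟨ofInterior G e ht b, rfl⟩
  have hf : Function.Bijective f := by
    constructor
    · intro b b' h
      simpa [f, ofInterior] using h
    · rintro ⟨⟨e', t', ht', b, h1, h2⟩, hd⟩
      have key := congrArg G.normalForm hd
      rw [base, G.normalForm_point e' ht', G.normalForm_point_of_mem_Ioo e ht] at key
      split_ifs at key
      obtain ⟨rfl, rfl⟩ := Prod.mk.inj (Sum.inr.inj key)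
      exact ⟨b, rfl⟩
  rw [← finsum_eq_of_bijective (f := fun i => (f i).1.image) f hf fun _ => rfl,
    finsum_eq_sum_of_fintype, Fintype.sum_bool]
  simp [f, image, ofInterior]

theorem finsum_image (q : G.Curve) :
    ∑ᶠ d : {d : G.UnitTangent // d.base = q}, d.1.image = 0 := by
  rcases G.exists_rep q with ⟨x, rfl⟩ | ⟨e, t, ht, rfl⟩
  exacts [finsum_image_vertexPoint x, finsum_image_of_mem_Ioo e ht]

end UnitTangent

variable [Fintype E]

theorem isPiecewiseAffine_abelJacobi (p : G.Curve) :
    G.IsPiecewiseAffine G.periods (G.abelJacobi p) := by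
  -- No subdivision is needed, the map being affine on whole edges.
  refine ⟨⟨fun _ => ∅, by simp⟩, fun a => ?_⟩
  obtain ⟨w, hw⟩ := G.exists_abelJacobi_point p a.1
  exact ⟨w, G.direction a.1, fun t ht => hw t (Subdivision.Icc_subset _ a ht)⟩

theorem isTropical_abelJacobi (p : G.Curve) :
    G.IsTropical G.periods G.integralDual (G.abelJacobi p) :=
  ⟨G.continuous_abelJacobi p, isPiecewiseAffine_abelJacobi p, UnitTangent.image,
    UnitTangent.hasDifferential_abelJacobi p, UnitTangent.image_mem_integralDual,
    UnitTangent.finsum_image⟩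

end Tropical

end WeightedGraph

theorem mainTheorem9 {V : Type u} {E : Type v} [Finite V] [Fintype E] (G : WeightedGraph V E)
    (p : G.Curve) :
    -- independence of the choice of refinement and path
    (∀ (q : G.Curve) (c : G.Connection p q),
      G.abelJacobi p q = QuotientAddGroup.mk c.functional) ∧
    -- continuity
    Continuous (G.abelJacobi p) ∧
    -- lifts on simply connected subgraphs, unique when normalized at `p`
    (∀ X : Set G.Curve, G.IsSubgraph X → SimplyConnectedSpace X → ∀ hp : p ∈ X,
      ∃! F : X → G.HarmonicDual, G.IsLift p X F ∧ F ⟨p, hp⟩ = 0) ∧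
    -- bridges are collapsed
    (∀ e : E, ¬ IsConnected (G.openSegment e)ᶜ →
      ∃ z : G.Jacobian, G.abelJacobi p '' G.segment e = {z}) ∧
    -- any lift sends any other segment to a straight segment, in an affine way
    (∀ e : E, IsConnected (G.openSegment e)ᶜ →
      ∀ X : Set G.Curve, G.IsSubgraph X → SimplyConnectedSpace X → p ∈ X → G.segment e ⊆ X →
        ∀ F : X → G.HarmonicDual, G.IsLift p X F →
          ∃ a b : G.HarmonicDual, a ≠ b ∧
            F '' {x : X | (x : G.Curve) ∈ G.segment e} = segment ℝ a b ∧
            ∀ (t : ℝ) (x : X), t ∈ Set.Icc 0 (G.len e) → (x : G.Curve) = G.point e t →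
              F x = AffineMap.lineMap a b (t / G.len e)) ∧
    -- integrality and primitivity of the directions
    (∀ e : E, (1 / G.len e) • G.edgeFunctional e ∈ G.integralDual ∧
      (G.edgeFunctional e ≠ 0 →
        IsPrimitiveIn G.integralDual ((1 / G.len e) • G.edgeFunctional e))) ∧
    -- the map is tropical
    G.IsTropical G.periods G.integralDual (G.abelJacobi p) := by
  refine ⟨fun q c => (G.abelJacobi_eq p q).trans (G.mk_functional c).symm,
    G.continuous_abelJacobi p, fun X hX hs hp => WeightedGraph.existsUnique_isLift p hX hp,
    fun e he => WeightedGraph.exists_abelJacobi_image_segment_eq p he,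
    fun e he X _ _ _ hX F hF => hF.image_segment he hX,
    fun e => ⟨G.direction_mem_integralDual e, WeightedGraph.isPrimitiveIn_direction⟩,
    WeightedGraph.isTropical_abelJacobi p⟩
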